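/- Let $n\ge 1$ and $1<p<\infty$. Cubes $Q\subset\mathbb{R}^n$ are half-open with sides parallel to the axes, $l(Q)$ is the side length and $\tilde Q=\{(x,t): x\in Q,\ 0\le t<l(Q)\}$. For a locally integrable $f$ on $\mathbb{R}^n$ put $$\mathcal{M}f(x,t)=\sup_{Q\ni x,\ l(Q)\ge t}\frac1{|Q|}\int_Q|f(y)|\,dy\quad(x\in\mathbb{R}^n,\ t\ge 0),\qquad Mf(x)=\sup_{Q\ni x}\frac1{|Q|}\int_Q|f(y)|\,dy .$$ There is a constant $C<\infty$, depending only on $n$ and $p$, such that the following holds. Let $\mu$ be a positive Borel measure on $\mathbb{R}^{n+1}_+=\mathbb{R}^n\times[0,\infty)$, let $\sigma\ge 0$ be a weight (a locally integrable function) on $\mathbb{R}^n$, with $\sigma(Q)=\int_Q\sigma\,dx$, and let $\varepsilon:(1/2,\infty)\to(0,\infty)$ be an increasing (i.e. nondecreasing) function with $$\int_{1/2}^\infty\frac{1}{\varepsilon(t)}\,\frac{dt}{t}=1 .$$ Then $$\|\mathcal{M}(\cdot\,\sigma)\|_{L^p(\sigma)\to L^p(\mathbb{R}^{n+1}_+,\mu)}\le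 C\,\lceil\mu,\sigma\rceil_{p,\varepsilon}^{1/p},$$ where $$\lceil\mu,\sigma\rceil_{p,\varepsilon}=\sup_Q\ \rho(Q)\,\varepsilon(\rho(Q))\left(\frac{\sigma(Q)}{|Q|}\right)^{p-1}\frac{\mu(\tilde Q)}{|Q|},\qquad \rho(Q)=\frac{1}{\sigma(Q)}\int_Q M(\sigma\chi_Q)\,dx ,$$ the supremum being over all cubes $Q$ of $\mathbb{R}^n$. Here both sides may be infinite, $\rho(Q)\varepsilon(\rho(Q))=\infty$ if $\rho(Q)=\infty$, $0\cdot\infty=0$, and cubes with $\sigma(Q)=0$ contribute $0$. -/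

import Mathlib

open MeasureTheory Set
open scoped ENNReal NNReal

noncomputable section

namespace Carleson

/-- A cube of `ℝⁿ` with sides parallel to the axes, given by its lower corner and its
side length `l(Q) > 0`. -/
structure Cube (n : ℕ) where
  corner : Fin n → ℝ
  side : ℝ
  side_pos : 0 < side

/-- The points of the (half-open) cube: `∏ᵢ [aᵢ, aᵢ + l)`. -/
def Cube.set {n : ℕ} (Q : Cube n) : Set (Fin n → ℝ) :=
  Set.univ.pi fun i => Set.Ico (Q.corner i) (Q.corner i + Q.side)

/-- The closed upper half space `{(x, t) : x ∈ ℝⁿ, t ≥ 0}`. -/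
abbrev UpperHalfSpace (n : ℕ) : Type := (Fin n → ℝ) × ℝ≥0

/-- The cube `Q̃ = {(x, t) : x ∈ Q, 0 ≤ t < l(Q)}` over `Q`. -/
def Cube.tent {n : ℕ} (Q : Cube n) : Set (UpperHalfSpace n) :=
  {z | z.1 ∈ Q.set ∧ (z.2 : ℝ) < Q.side}

/-- The average `|Q|⁻¹ ∫_Q |g(y)| dy`. -/
def Cube.average {n : ℕ} (Q : Cube n) (g : (Fin n → ℝ) → ℝ) : ℝ≥0∞ :=
  (∫⁻ y in Q.set, ‖g y‖ₑ) / volume Q.set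

/-- The maximal operator `𝓜 g(x, t) = sup_{x ∈ Q, l(Q) ≥ t} |Q|⁻¹ ∫_Q |g|` on the upper half
space. -/
def maximalUpper {n : ℕ} (g : (Fin n → ℝ) → ℝ) (z : UpperHalfSpace n) : ℝ≥0∞ :=
  ⨆ (Q : Cube n) (_ : z.1 ∈ Q.set) (_ : (z.2 : ℝ) ≤ Q.side), Q.average g

/-- The uncentred Hardy-Littlewood maximal operator `M g(x) = sup_{x ∈ Q} |Q|⁻¹ ∫_Q |g|`. -/
def maximalHL {n : ℕ} (g : (Fin n → ℝ) → ℝ) (x : Fin n → ℝ) : ℝ≥0∞ :=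
  ⨆ (Q : Cube n) (_ : x ∈ Q.set), Q.average g

/-- The measure `σ dx` on `ℝⁿ` with density the weight `σ`. -/
def weightMeasure {n : ℕ} (σ : (Fin n → ℝ) → ℝ) : Measure (Fin n → ℝ) :=
  volume.withDensity fun x => ENNReal.ofReal (σ x)

/-- `ρ(Q) = σ(Q)⁻¹ ∫_Q M(σ χ_Q) dx` (which may be `∞`). -/
def entropy {n : ℕ} (σ : (Fin n → ℝ) → ℝ) (Q : Cube n) : ℝ≥0∞ :=
  (∫⁻ x in Q.set, maximalHL (Q.set.indicator σ) x) / weightMeasure σ Q.set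

/-- The function `r ↦ r ε(r)`, with value `∞` at `r = ∞`. -/
def bump (ε : ℝ → ℝ) (r : ℝ≥0∞) : ℝ≥0∞ :=
  if r = ∞ then ∞ else r * ENNReal.ofReal (ε r.toReal)

/-- The entropy bump constant
`⌈μ, σ⌉_{p,ε} = sup_Q ρ(Q) ε(ρ(Q)) (σ(Q) / |Q|)^{p-1} μ(Q̃) / |Q|`. If `p > 1`, cubes with
`σ(Q) = 0` contribute `0`. -/
def entropyBumpConst {n : ℕ} (p : ℝ) (ε : ℝ → ℝ) (μ : Measure (UpperHalfSpace n))
    (σ : (Fin n → ℝ) → ℝ) : ℝ≥0∞ :=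
  ⨆ Q : Cube n, bump ε (entropy σ Q) *
    (weightMeasure σ Q.set / volume Q.set) ^ (p - 1) * (μ Q.tent / volume Q.set)

/-- The norm of `f ↦ 𝓜(f σ)` from `L^p(σ)` to `L^p(μ)`: the supremum of
`‖𝓜(f σ)‖_{L^p(μ)}` over the unit ball of `L^p(σ)`. -/
def maximalOpNorm {n : ℕ} (p : ℝ) (μ : Measure (UpperHalfSpace n))
    (σ : (Fin n → ℝ) → ℝ) : ℝ≥0∞ :=
  ⨆ (f : (Fin n → ℝ) → ℝ) (_ : MemLp f (ENNReal.ofReal p) (weightMeasure σ))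
    (_ : eLpNorm f (ENNReal.ofReal p) (weightMeasure σ) ≤ 1),
    eLpNorm (maximalUpper fun y => f y * σ y) (ENNReal.ofReal p) μ

end Carleson

end

namespace Carleson

/-! ### Dyadic level sums in `ℝ≥0∞` -/

/-! Every cube lies in a comparable cube from one of `2 ^ n` nested grids, so it suffices to bound
the supremum over finite nested families. For a cube `Q`, the average of `|f|σ` factors as `density
σ Q * A(Q)`, where `A(Q)` is the `σ`-average of `|f|`. The cubes are sorted three times: by entropy
`ρ(Q) ~ 2 ^ r`, by `A(Q) ~ 2 ^ k` and by density `~ 2 ^ j`.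

For fixed `r`, the bump condition reads `density ^ (p - 1) * μ(tent) ≤ K * |Q|` with `K` equal to
the bump constant over `2 ^ r * ε(2 ^ r)`. Applied to maximal cubes, it turns the `μ`-measure of a
level, weighted by `2 ^ (jp)`, into Lebesgue measure weighted by `2 ^ j` (`measure_tents_le`).
Summing over `j` gives a geometric series dominated by `M(σχ_R)` on each maximal cube `R` with `A(R)
≥ 2 ^ k`; its integral is at most `2 ^ (r + 1) σ(R)` by the definition of entropy
(`tsum_density_level_le`). What remains is the sum of `2 ^ (kp)` times the `σ`-measure of the union
of cubes with `A ≥ 2 ^ k`, controlled by the maximal theorem for the measure `σ dx`, which needs no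
doubling because the family is nested (`tsum_level_measure_le`).

The powers of `2 ^ r` cancel, leaving `∑ 1 / ε(2 ^ r)`, which the integral condition bounds
(`tsum_inv_eps_le`). -/

lemma two_rpow_add (x y : ℝ) : (2 : ℝ≥0∞) ^ (x + y) = 2 ^ x * 2 ^ y :=
  ENNReal.rpow_add x y (by norm_num) (by norm_num)

/-- Exactly one dyadic level contains a nonzero finite `x`. Finiteness matters: `∞` lies in no
level, and the sum would be `0`. -/
lemma rpow_le_tsum_levels {p : ℝ} (hp : 0 < p) {x : ℝ≥0∞} (hx : x ≠ ∞) :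
    x ^ p ≤ ∑' k : ℤ, if (2 : ℝ≥0∞) ^ (k : ℝ) ≤ x ∧ x < 2 ^ ((k : ℝ) + 1) then
      (2 : ℝ≥0∞) ^ (((k : ℝ) + 1) * p) else 0 := by
  rcases eq_or_ne x 0 with rfl | h0
  · simp [hp]
  obtain ⟨k, hk1, hk2⟩ := ENNReal.exists_mem_Ico_zpow h0 hx (y := 2) (by norm_num) (by norm_num)
  rw [← ENNReal.rpow_intCast] at hk1 hk2
  push_cast at hk2
  refine le_trans ?_ (ENNReal.le_tsum k)
  rw [if_pos ⟨hk1, hk2⟩, ENNReal.rpow_mul]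
  exact ENNReal.rpow_le_rpow hk2.le hp.le

/-- The constant `∑_{m ≥ 0} 2^{-ms}`. -/
noncomputable def geomConst (s : ℝ) : ℝ≥0∞ := (1 - (2 : ℝ≥0∞) ^ (-s))⁻¹

lemma geomConst_ne_top {s : ℝ} (hs : 0 < s) : geomConst s ≠ ∞ := by
  have : (2 : ℝ≥0∞) ^ (-s) < 1 := ENNReal.rpow_lt_one_of_one_lt_of_neg (by norm_num) (by linarith)
  simpa [geomConst, tsub_eq_zero_iff_le] using this

lemma geomConst_ne_zero (s : ℝ) : geomConst s ≠ 0 :=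
  ENNReal.inv_ne_zero.mpr (ENNReal.sub_ne_top ENNReal.one_ne_top)

/-- Counted downwards from the top level `2 ^ K ≤ x`, the terms form a geometric series of ratio `2
^ (-s)`. -/
lemma tsum_levels_le {s : ℝ} (hs : 0 < s) (x : ℝ≥0∞) :
    (∑' k : ℤ, if (2 : ℝ≥0∞) ^ (k : ℝ) ≤ x then (2 : ℝ≥0∞) ^ ((k : ℝ) * s) else 0) ≤
      geomConst s * x ^ s := by
  rcases eq_or_ne x 0 with rfl | h0
  · have : ∀ k : ℤ, ¬ (2 : ℝ≥0∞) ^ (k : ℝ) ≤ 0 := fun k => by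
      rw [not_le]; exact ENNReal.rpow_pos (by norm_num) (by norm_num)
    simp only [this, if_false, tsum_zero, zero_le]
  rcases eq_or_ne x ∞ with rfl | hx
  · rw [ENNReal.top_rpow_of_pos hs, ENNReal.mul_top (geomConst_ne_zero s)]
    exact le_top
  obtain ⟨K, hK1, hK2⟩ := ENNReal.exists_mem_Ico_zpow h0 hx (y := 2) (by norm_num) (by norm_num)
  rw [← ENNReal.rpow_intCast] at hK1 hK2
  have hinj : Function.Injective fun m : ℕ => K - (m : ℤ) := fun a b h => by
    simp only at h; omega
  rw [← hinj.tsum_eq]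
  · calc _ ≤ ∑' m : ℕ, (2 : ℝ≥0∞) ^ ((K : ℝ) * s) * ((2 : ℝ≥0∞) ^ (-s)) ^ m := by
          refine ENNReal.tsum_le_tsum fun m => ?_
          split_ifs
          · rw [← ENNReal.rpow_natCast, ← ENNReal.rpow_mul, ← two_rpow_add]
            refine le_of_eq ?_
            congr 1; push_cast; ring
          · exact zero_le
      _ = (2 : ℝ≥0∞) ^ ((K : ℝ) * s) * geomConst s := by
          rw [ENNReal.tsum_mul_left, ENNReal.tsum_geometric, geomConst]
      _ ≤ _ := by
          rw [mul_comm, ENNReal.rpow_mul]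
          gcongr
  · intro k hk
    have hk' : (2 : ℝ≥0∞) ^ (k : ℝ) ≤ x := by
      by_contra h
      exact hk (if_neg h)
    have h1 : (k : ℝ) < ((K + 1 : ℤ) : ℝ) := by
      by_contra h
      rw [not_lt] at h
      have := ENNReal.rpow_le_rpow_of_exponent_le (x := 2) (by norm_num) h
      exact absurd (hk'.trans_lt hK2) (not_lt.mpr this)
    have h2 : k < K + 1 := by exact_mod_cast h1
    exact ⟨(K - k).toNat, by simp only; omega⟩

/-! ### Cubes -/

variable {n : ℕ}

lemma Cube.measurableSet (Q : Cube n) : MeasurableSet Q.set :=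
  MeasurableSet.univ_pi fun _ => measurableSet_Ico

lemma Cube.measurableSet_tent (Q : Cube n) : MeasurableSet Q.tent :=
  (measurable_fst Q.measurableSet).inter
    (measurableSet_lt (measurable_snd.coe_nnreal_real) measurable_const)

lemma Cube.volume_set (Q : Cube n) : volume Q.set = ENNReal.ofReal Q.side ^ n := by
  simp [Cube.set, Real.volume_pi_Ico]

lemma Cube.volume_ne_zero (Q : Cube n) : volume Q.set ≠ 0 := by
  rw [Q.volume_set]
  exact pow_ne_zero _ (by simpa using Q.side_pos)

lemma Cube.volume_ne_top (Q : Cube n) : volume Q.set ≠ ∞ := by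
  rw [Q.volume_set]
  exact ENNReal.pow_ne_top ENNReal.ofReal_ne_top

/-- In dimension `0` all cubes are the same point whatever their side; `0 < n` is what lets
inclusion control the side lengths. -/
lemma Cube.tent_mono (hn : 0 < n) {Q R : Cube n} (h : Q.set ⊆ R.set) : Q.tent ⊆ R.tent := by
  have hne : Q.set.Nonempty := ⟨Q.corner, fun i _ => ⟨le_rfl, by linarith [Q.side_pos]⟩⟩
  have hside : Q.side ≤ R.side := by
    rw [Cube.set, Cube.set, Set.pi_subset_pi_iff] at h
    rcases h with h | h
    · have := (Set.Ico_subset_Ico_iff (by linarith [Q.side_pos])).1 (h ⟨0, hn⟩ (mem_univ _))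
      linarith
    · exact absurd h hne.ne_empty
  exact fun z hz => ⟨h hz.1, hz.2.trans_le hside⟩

/-- Two cubes are nested or disjoint. -/
def Nested (Q R : Cube n) : Prop := Q.set ⊆ R.set ∨ R.set ⊆ Q.set ∨ Disjoint Q.set R.set

lemma exists_disjoint_cover (F : Finset (Cube n)) (hF : ∀ Q ∈ F, ∀ R ∈ F, Nested Q R) :
    ∃ G ⊆ F, (∀ Q ∈ F, ∃ R ∈ G, Q.set ⊆ R.set) ∧
      (G : Set (Cube n)).PairwiseDisjoint Cube.set := by
  classical
  induction F using Finset.induction_on with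
  | empty => exact ⟨∅, by simp⟩
  | insert Q F _ ih =>
    obtain ⟨G, hGF, hcov, hdis⟩ := ih fun A hA B hB =>
      hF A (Finset.mem_insert_of_mem hA) B (Finset.mem_insert_of_mem hB)
    by_cases hQ : ∃ R ∈ G, Q.set ⊆ R.set
    · refine ⟨G, hGF.trans (Finset.subset_insert _ _), ?_, hdis⟩
      intro A hA
      rcases Finset.mem_insert.1 hA with rfl | hA
      · exact hQ
      · exact hcov A hA
    · push Not at hQ
      -- The new cube lies in no earlier maximal cube, so it becomes maximal itself and absorbs
      -- those contained in it.
      refine ⟨insert Q (G.filter fun R => ¬ R.set ⊆ Q.set), ?_, ?_, ?_⟩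
      · exact Finset.insert_subset_insert _ ((Finset.filter_subset _ _).trans hGF)
      · intro A hA
        rcases Finset.mem_insert.1 hA with rfl | hA
        · exact ⟨A, Finset.mem_insert_self _ _, subset_rfl⟩
        obtain ⟨R, hR, hAR⟩ := hcov A hA
        by_cases hRQ : R.set ⊆ Q.set
        · exact ⟨Q, Finset.mem_insert_self _ _, hAR.trans hRQ⟩
        · exact ⟨R, Finset.mem_insert_of_mem (Finset.mem_filter.2 ⟨hR, hRQ⟩), hAR⟩
      · rw [Finset.coe_insert]
        refine PairwiseDisjoint.insert (hdis.subset ?_) ?_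
        · exact Finset.coe_subset.2 (Finset.filter_subset _ _)
        · intro R hR _
          obtain ⟨hRG, hRQ⟩ := Finset.mem_filter.1 (Finset.mem_coe.1 hR)
          rcases hF Q (Finset.mem_insert_self _ _) R (Finset.mem_insert_of_mem (hGF hRG)) with
            h | h | h
          · exact absurd h (hQ R hRG)
          · exact absurd h hRQ
          · exact h

/-! ### Averages of the weight and the entropy -/

lemma weightMeasure_apply (σ : (Fin n → ℝ) → ℝ) (Q : Cube n) :
    weightMeasure σ Q.set = ∫⁻ x in Q.set, ENNReal.ofReal (σ x) :=
  withDensity_apply _ Q.measurableSet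

lemma weightMeasure_ne_top {σ : (Fin n → ℝ) → ℝ} (hσ : LocallyIntegrable σ volume) (Q : Cube n) :
    weightMeasure σ Q.set ≠ ∞ := by
  have hsub : Q.set ⊆ Icc Q.corner (fun i => Q.corner i + Q.side) := fun x hx =>
    ⟨fun i => (hx i (mem_univ i)).1, fun i => (hx i (mem_univ i)).2.le⟩
  have h : IntegrableOn σ Q.set := (hσ.integrableOn_isCompact isCompact_Icc).mono_set hsub
  rw [weightMeasure_apply]
  exact (lt_of_le_of_lt (lintegral_mono fun x => Real.ofReal_le_enorm _) h.2).ne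

lemma average_indicator {σ : (Fin n → ℝ) → ℝ} (hσ : ∀ x, 0 ≤ σ x) {Q R : Cube n}
    (h : Q.set ⊆ R.set) :
    Q.average (R.set.indicator σ) = weightMeasure σ Q.set / volume Q.set := by
  rw [Cube.average, weightMeasure_apply]
  congr 1
  refine setLIntegral_congr_fun Q.measurableSet fun x hx => ?_
  simp only [indicator_of_mem (h hx)]
  exact Real.enorm_of_nonneg (hσ x)

lemma le_maximalHL {σ : (Fin n → ℝ) → ℝ} (hσ : ∀ x, 0 ≤ σ x) {Q R : Cube n}
    (h : Q.set ⊆ R.set) {x : Fin n → ℝ} (hx : x ∈ Q.set) :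
    weightMeasure σ Q.set / volume Q.set ≤ maximalHL (R.set.indicator σ) x := by
  rw [← average_indicator hσ h]
  exact le_iSup₂_of_le Q hx le_rfl

lemma weightMeasure_le_lintegral_maximalHL {σ : (Fin n → ℝ) → ℝ} (hσ : ∀ x, 0 ≤ σ x)
    (Q : Cube n) :
    weightMeasure σ Q.set ≤ ∫⁻ x in Q.set, maximalHL (Q.set.indicator σ) x := by
  calc weightMeasure σ Q.set = ∫⁻ _ in Q.set, weightMeasure σ Q.set / volume Q.set := by
        rw [setLIntegral_const, ENNReal.div_mul_cancel Q.volume_ne_zero Q.volume_ne_top]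
    _ ≤ _ := setLIntegral_mono' Q.measurableSet fun x hx => le_maximalHL hσ subset_rfl hx

lemma one_le_entropy {σ : (Fin n → ℝ) → ℝ} (hσ : ∀ x, 0 ≤ σ x)
    (hloc : LocallyIntegrable σ volume) {Q : Cube n} (hQ : weightMeasure σ Q.set ≠ 0) :
    1 ≤ entropy σ Q := by
  rw [entropy, ENNReal.le_div_iff_mul_le (Or.inl hQ) (Or.inl (weightMeasure_ne_top hloc Q)),
    one_mul]
  exact weightMeasure_le_lintegral_maximalHL hσ Q

lemma average_mul_eq {σ f : (Fin n → ℝ) → ℝ} (hσ : ∀ x, 0 ≤ σ x)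
    (hloc : LocallyIntegrable σ volume) (hf : AEStronglyMeasurable f (weightMeasure σ))
    (Q : Cube n) :
    Q.average (fun y => f y * σ y) = weightMeasure σ Q.set / volume Q.set *
      ((∫⁻ y in Q.set, ‖f y‖ₑ ∂weightMeasure σ) / weightMeasure σ Q.set) := by
  have hm : AEMeasurable (fun x => ENNReal.ofReal (σ x)) volume :=
    hloc.aestronglyMeasurable.aemeasurable.ennreal_ofReal
  have h1 : ∫⁻ y in Q.set, ‖f y * σ y‖ₑ = ∫⁻ y in Q.set, ‖f y‖ₑ ∂weightMeasure σ := by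
    rw [weightMeasure, restrict_withDensity Q.measurableSet,
      lintegral_withDensity_eq_lintegral_mul₀' hm.restrict]
    · refine lintegral_congr fun y => ?_
      rw [enorm_mul, Real.enorm_of_nonneg (hσ y), Pi.mul_apply, mul_comm]
    · rw [← restrict_withDensity Q.measurableSet]
      exact hf.enorm.restrict
  rw [Cube.average, h1]
  -- If `σ(Q) = 0`, both sides vanish; otherwise `σ(Q)` cancels, being finite.
  rcases eq_or_ne (weightMeasure σ Q.set) 0 with h0 | h0
  · rw [Measure.restrict_eq_zero.2 h0]
    simp
  · rw [div_eq_mul_inv, div_eq_mul_inv, div_eq_mul_inv]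
    calc _ = (weightMeasure σ Q.set * (weightMeasure σ Q.set)⁻¹) *
          ((∫⁻ y in Q.set, ‖f y‖ₑ ∂weightMeasure σ) * (volume Q.set)⁻¹) := by
          rw [ENNReal.mul_inv_cancel h0 (weightMeasure_ne_top hloc Q), one_mul]
      _ = _ := by ring

open Classical in
/-- The union of the cubes of `F` satisfying `P`. -/
noncomputable def unionOf (F : Finset (Cube n)) (P : Cube n → Prop) : Set (Fin n → ℝ) :=
  ⋃ Q ∈ F.filter P, Q.set

lemma mem_unionOf {F : Finset (Cube n)} {P : Cube n → Prop} {x : Fin n → ℝ} :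
    x ∈ unionOf F P ↔ ∃ Q ∈ F, P Q ∧ x ∈ Q.set := by
  simp [unionOf, and_assoc]

lemma measurableSet_unionOf (F : Finset (Cube n)) (P : Cube n → Prop) :
    MeasurableSet (unionOf F P) :=
  Finset.measurableSet_biUnion _ fun Q _ => Q.measurableSet

/-- The maximal cubes of a finite nested family that satisfy a given property. -/
lemma exists_maximal_cover (F : Finset (Cube n)) (hF : ∀ Q ∈ F, ∀ R ∈ F, Nested Q R)
    (P : Cube n → Prop) :
    ∃ G ⊆ F, (∀ R ∈ G, P R) ∧ (∀ Q ∈ F, P Q → ∃ R ∈ G, Q.set ⊆ R.set) ∧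
      (∀ ν : Measure (Fin n → ℝ), ∑ R ∈ G, ν R.set = ν (unionOf F P)) ∧
      unionOf F P = ⋃ R ∈ G, R.set ∧ (G : Set (Cube n)).PairwiseDisjoint Cube.set := by
  classical
  obtain ⟨G, hGF, hcov, hdis⟩ := exists_disjoint_cover (F.filter P) fun Q hQ R hR =>
    hF Q (Finset.mem_filter.1 hQ).1 R (Finset.mem_filter.1 hR).1
  have hU : unionOf F P = ⋃ R ∈ G, R.set := by
    ext x
    rw [mem_unionOf]
    simp only [mem_iUnion, exists_prop]
    constructor
    · rintro ⟨Q, hQ, hP, hx⟩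
      obtain ⟨R, hR, hQR⟩ := hcov Q (Finset.mem_filter.2 ⟨hQ, hP⟩)
      exact ⟨R, hR, hQR hx⟩
    · rintro ⟨R, hR, hx⟩
      obtain ⟨h1, h2⟩ := Finset.mem_filter.1 (hGF hR)
      exact ⟨R, h1, h2, hx⟩
  refine ⟨G, hGF.trans (Finset.filter_subset _ _), fun R hR => (Finset.mem_filter.1 (hGF hR)).2,
    fun Q hQ hP => hcov Q (Finset.mem_filter.2 ⟨hQ, hP⟩), fun ν => ?_, hU, hdis⟩
  rw [hU, measure_biUnion_finset hdis fun R _ => R.measurableSet]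

/-! ### The weighted maximal theorem for finite families -/

/-- On a maximal cube the part of `g` below `t` contributes at most half of an average that is at
least `2 * t`, so the part above `t` carries the rest. Maximal cubes are disjoint, so these
estimates add up. -/
lemma level_weak_type (ν : Measure (Fin n → ℝ)) {g : (Fin n → ℝ) → ℝ≥0∞} (hg : Measurable g)
    (F : Finset (Cube n)) (hF : ∀ Q ∈ F, ∀ R ∈ F, Nested Q R) (hν : ∀ Q ∈ F, ν Q.set ≠ ∞)
    (t : ℝ≥0∞) (ht : t ≠ ∞) :
    t * ν (unionOf F fun Q => 2 * t ≤ (∫⁻ y in Q.set, g y ∂ν) / ν Q.set) ≤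
      ∫⁻ y, {y | t ≤ g y}.indicator g y ∂ν := by
  obtain ⟨G, hGF, hGP, -, hsum, hU, hdis⟩ := exists_maximal_cover F hF
    fun Q => 2 * t ≤ (∫⁻ y in Q.set, g y ∂ν) / ν Q.set
  have hms : MeasurableSet {y | t ≤ g y} := measurableSet_le measurable_const hg
  rw [← hsum, Finset.mul_sum]
  calc ∑ R ∈ G, t * ν R.set ≤ ∑ R ∈ G, ∫⁻ y in R.set, {y | t ≤ g y}.indicator g y ∂ν := by
        refine Finset.sum_le_sum fun R hR => ?_
        have h1 : 2 * t * ν R.set ≤ ∫⁻ y in R.set, g y ∂ν := ENNReal.mul_le_of_le_div (hGP R hR)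
        have h2 : ∫⁻ y in R.set, g y ∂ν ≤
            ∫⁻ y in R.set, {y | t ≤ g y}.indicator g y ∂ν + t * ν R.set := by
          calc _ ≤ ∫⁻ y in R.set, ({y | t ≤ g y}.indicator g y + t) ∂ν := by
                refine lintegral_mono fun y => ?_
                by_cases hy : t ≤ g y
                · rw [indicator_of_mem (show y ∈ {y | t ≤ g y} from hy)]
                  exact le_self_add
                · exact (not_le.1 hy).le.trans le_add_self
            _ = _ := by
                rw [lintegral_add_right _ measurable_const, setLIntegral_const]
        -- Finiteness allows one copy of `t * ν R.set` to be cancelled from both sides.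
        have hne : t * ν R.set ≠ ∞ := ENNReal.mul_ne_top ht (hν R (hGF hR))
        rw [mul_assoc, two_mul] at h1
        exact (ENNReal.add_le_add_iff_right hne).1 (h1.trans h2)
    _ = ∫⁻ y in ⋃ R ∈ G, R.set, {y | t ≤ g y}.indicator g y ∂ν :=
        (lintegral_biUnion_finset hdis (fun R _ => R.measurableSet) _).symm
    _ ≤ _ := setLIntegral_le_lintegral _ _

/-- This is Marcinkiewicz interpolation in discrete form: the weak-type bound for the truncated
function is summed over dyadic heights, and the sum is taken inside the integral. -/
lemma tsum_level_measure_le {p : ℝ} (hp : 1 < p) (ν : Measure (Fin n → ℝ))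
    {g : (Fin n → ℝ) → ℝ≥0∞} (hg : Measurable g)
    (F : Finset (Cube n)) (hF : ∀ Q ∈ F, ∀ R ∈ F, Nested Q R) (hν : ∀ Q ∈ F, ν Q.set ≠ ∞) :
    ∑' k : ℤ, (2 : ℝ≥0∞) ^ (((k : ℝ) + 1) * p) *
        ν (unionOf F fun Q => (2 : ℝ≥0∞) ^ (k : ℝ) ≤ (∫⁻ y in Q.set, g y ∂ν) / ν Q.set) ≤
      2 ^ (2 * p) * geomConst (p - 1) * ∫⁻ y, g y ^ p ∂ν := by
  -- The shift `k = i + 1` writes the threshold as `2 * 2 ^ i`, the form the weak-type bound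
  -- requires.
  rw [← (Equiv.addRight (1 : ℤ)).tsum_eq]
  have hms : ∀ t : ℝ≥0∞, MeasurableSet {y | t ≤ g y} := fun t =>
    measurableSet_le measurable_const hg
  have htop : ∀ x : ℝ, (2 : ℝ≥0∞) ^ x ≠ ∞ := fun x => by simp
  calc _ ≤ ∑' i : ℤ, (2 : ℝ≥0∞) ^ (2 * p) * ((2 : ℝ≥0∞) ^ ((i : ℝ) * (p - 1)) *
          ∫⁻ y, {y | (2 : ℝ≥0∞) ^ (i : ℝ) ≤ g y}.indicator g y ∂ν) := by
        refine ENNReal.tsum_le_tsum fun i => ?_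
        have hw := level_weak_type ν hg F hF hν ((2 : ℝ≥0∞) ^ (i : ℝ)) (htop _)
        have e1 : (2 : ℝ≥0∞) ^ (((Equiv.addRight (1 : ℤ) i : ℤ) : ℝ)) = 2 * 2 ^ (i : ℝ) := by
          rw [Equiv.coe_addRight, Int.cast_add, two_rpow_add, mul_comm]; simp
        have e2 : (2 : ℝ≥0∞) ^ ((((Equiv.addRight (1 : ℤ) i : ℤ) : ℝ) + 1) * p) =
            2 ^ (2 * p) * (2 ^ ((i : ℝ) * (p - 1)) * 2 ^ (i : ℝ)) := by
          rw [← two_rpow_add, ← two_rpow_add, Equiv.coe_addRight]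
          congr 1; push_cast; ring
        simp only [e1, e2]
        rw [mul_assoc, mul_assoc]
        gcongr
    _ = (2 : ℝ≥0∞) ^ (2 * p) * ∫⁻ y, ∑' i : ℤ, (2 : ℝ≥0∞) ^ ((i : ℝ) * (p - 1)) *
          {y | (2 : ℝ≥0∞) ^ (i : ℝ) ≤ g y}.indicator g y ∂ν := by
        rw [ENNReal.tsum_mul_left, lintegral_tsum]
        · congr 2
          funext i
          rw [lintegral_const_mul _ (hg.indicator (hms _))]
        · exact fun i => ((hg.indicator (hms _)).const_mul _).aemeasurable
    _ ≤ (2 : ℝ≥0∞) ^ (2 * p) * ∫⁻ y, geomConst (p - 1) * g y ^ p ∂ν := by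
        gcongr with y
        calc _ = (∑' i : ℤ, if (2 : ℝ≥0∞) ^ (i : ℝ) ≤ g y then
                (2 : ℝ≥0∞) ^ ((i : ℝ) * (p - 1)) else 0) * g y := by
              rw [← ENNReal.tsum_mul_right]
              refine tsum_congr fun i => ?_
              simp only [indicator, mem_ofPred_eq, ite_mul, zero_mul, mul_ite, mul_zero]
          _ ≤ geomConst (p - 1) * g y ^ (p - 1) * g y := by
              gcongr
              exact tsum_levels_le (by linarith) _
          _ = _ := by
              rw [mul_assoc]
              congr 1
              nth_rewrite 2 [← ENNReal.rpow_one (g y)]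
              rw [← ENNReal.rpow_add_of_nonneg _ _ (by linarith) zero_le_one]
              simp
    _ = _ := by
        rw [lintegral_const_mul _ (hg.pow_const p), mul_assoc]

/-! ### The estimate for a finite nested family -/

/-- The average `σ(Q) / |Q|`. -/
noncomputable def density (σ : (Fin n → ℝ) → ℝ) (Q : Cube n) : ℝ≥0∞ :=
  weightMeasure σ Q.set / volume Q.set

/-- Inside a maximal cube `R`, a point covered by some `Q ⊆ R` of density at least `2 ^ j` has
`M(σχ_R) ≥ 2 ^ j`. The sum of these `2 ^ j` is therefore at most `geomConst 1` times `M(σχ_R)`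
pointwise, and `hL` bounds its integral over `R`. -/
lemma tsum_density_level_le {σ : (Fin n → ℝ) → ℝ} (hσ : ∀ x, 0 ≤ σ x) (F : Finset (Cube n))
    (hF : ∀ Q ∈ F, ∀ R ∈ F, Nested Q R) {L : ℝ≥0∞}
    (hL : ∀ Q ∈ F, ∫⁻ x in Q.set, maximalHL (Q.set.indicator σ) x ≤ L * weightMeasure σ Q.set)
    (P : Cube n → Prop) :
    ∑' j : ℤ, (2 : ℝ≥0∞) ^ (j : ℝ) *
        volume (unionOf F fun Q => P Q ∧ (2 : ℝ≥0∞) ^ (j : ℝ) ≤ density σ Q) ≤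
      geomConst 1 * L * weightMeasure σ (unionOf F P) := by
  obtain ⟨G, hGF, -, hcov, hsum, hU, hdis⟩ := exists_maximal_cover F hF P
  set V : ℤ → Cube n → Set (Fin n → ℝ) := fun j R =>
    unionOf F fun Q => Q.set ⊆ R.set ∧ (2 : ℝ≥0∞) ^ (j : ℝ) ≤ density σ Q with hV
  have hVm : ∀ j R, MeasurableSet (V j R) := fun j R => measurableSet_unionOf _ _
  calc _ ≤ ∑' j : ℤ, ∑ R ∈ G, ∫⁻ x in R.set, (V j R).indicator (fun _ => 2 ^ (j : ℝ)) x := by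
        refine ENNReal.tsum_le_tsum fun j => ?_
        calc _ ≤ (2 : ℝ≥0∞) ^ (j : ℝ) * ∑ R ∈ G, volume (V j R ∩ R.set) := by
              gcongr
              refine (measure_mono ?_).trans (measure_biUnion_finset_le G _)
              intro x hx
              obtain ⟨Q, hQ, ⟨hP, hj⟩, hxQ⟩ := mem_unionOf.1 hx
              obtain ⟨R, hR, hQR⟩ := hcov Q hQ hP
              simp only [mem_iUnion, exists_prop]
              exact ⟨R, hR, mem_unionOf.2 ⟨Q, hQ, ⟨hQR, hj⟩, hxQ⟩, hQR hxQ⟩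
          _ = _ := by
              rw [Finset.mul_sum]
              refine Finset.sum_congr rfl fun R _ => ?_
              rw [lintegral_indicator_const (hVm j R), Measure.restrict_apply (hVm j R)]
    _ = ∑ R ∈ G, ∫⁻ x in R.set, ∑' j : ℤ, (V j R).indicator (fun _ => 2 ^ (j : ℝ)) x := by
        rw [Summable.tsum_finsetSum fun _ _ => ENNReal.summable]
        refine Finset.sum_congr rfl fun R _ => ?_
        rw [lintegral_tsum]
        exact fun j => (measurable_const.indicator (hVm j R)).aemeasurable
    _ ≤ ∑ R ∈ G, ∫⁻ x in R.set, geomConst 1 * maximalHL (R.set.indicator σ) x := by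
        refine Finset.sum_le_sum fun R _ => lintegral_mono fun x => ?_
        have := tsum_levels_le one_pos (maximalHL (R.set.indicator σ) x)
        rw [ENNReal.rpow_one] at this
        refine le_trans (ENNReal.tsum_le_tsum fun j => ?_) this
        by_cases hx : x ∈ V j R
        · obtain ⟨Q, -, ⟨hQR, hj⟩, hxQ⟩ := mem_unionOf.1 hx
          rw [indicator_of_mem hx, if_pos (hj.trans (le_maximalHL hσ hQR hxQ)), mul_one]
        · rw [indicator_of_notMem hx]
          exact zero_le
    _ ≤ ∑ R ∈ G, geomConst 1 * (L * weightMeasure σ R.set) := by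
        refine Finset.sum_le_sum fun R hR => ?_
        rw [lintegral_const_mul' _ _ (geomConst_ne_top one_pos)]
        gcongr
        exact hL R (hGF hR)
    _ = _ := by
        rw [← hsum, Finset.mul_sum]
        simp_rw [mul_assoc]

/-- The union of the tents over the cubes of `F` satisfying `P`. -/
def tentsOf (F : Finset (Cube n)) (P : Cube n → Prop) : Set (UpperHalfSpace n) :=
  ⋃ Q ∈ F, ⋃ (_ : P Q), Q.tent

lemma measurableSet_tentsOf (F : Finset (Cube n)) (P : Cube n → Prop) :
    MeasurableSet (tentsOf F P) :=
  Finset.measurableSet_biUnion _ fun Q _ => MeasurableSet.iUnion fun _ => Q.measurableSet_tent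

/-- Of the `p` powers of `2 ^ j`, `p - 1` are absorbed by the density in `hK` and one survives.
Tents over the maximal cubes cover all the tents, and the maximal cubes are disjoint. -/
lemma measure_tents_le (hn : 0 < n) {p : ℝ} (hp : 1 < p) {μ : Measure (UpperHalfSpace n)}
    {σ : (Fin n → ℝ) → ℝ} (F : Finset (Cube n)) (hF : ∀ Q ∈ F, ∀ R ∈ F, Nested Q R) {K : ℝ≥0∞}
    (hK : ∀ Q ∈ F, density σ Q ^ (p - 1) * μ Q.tent ≤ K * volume Q.set) (j : ℤ)
    (P : Cube n → Prop) (hP : ∀ Q, P Q → (2 : ℝ≥0∞) ^ (j : ℝ) ≤ density σ Q) :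
    (2 : ℝ≥0∞) ^ (((j : ℝ) + 1) * p) * μ (tentsOf F P) ≤
      2 ^ p * K * (2 ^ (j : ℝ) * volume (unionOf F P)) := by
  obtain ⟨G, hGF, hGP, hcov, hsum, hU, hdis⟩ := exists_maximal_cover F hF P
  have e : (2 : ℝ≥0∞) ^ (((j : ℝ) + 1) * p) =
      2 ^ p * 2 ^ (j : ℝ) * (2 ^ (j : ℝ)) ^ (p - 1) := by
    rw [← ENNReal.rpow_mul, ← two_rpow_add, ← two_rpow_add]
    congr 1; ring
  calc _ ≤ 2 ^ p * 2 ^ (j : ℝ) * (2 ^ (j : ℝ)) ^ (p - 1) * ∑ R ∈ G, μ R.tent := by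
        rw [e]
        gcongr
        refine (measure_mono ?_).trans (measure_biUnion_finset_le G _)
        refine iUnion₂_subset fun Q hQ => iUnion_subset fun hPQ => ?_
        obtain ⟨R, hR, hQR⟩ := hcov Q hQ hPQ
        exact (Cube.tent_mono hn hQR).trans (subset_biUnion_of_mem (u := fun R => R.tent) hR)
    _ = 2 ^ p * 2 ^ (j : ℝ) * ∑ R ∈ G, (2 ^ (j : ℝ)) ^ (p - 1) * μ R.tent := by
        rw [mul_assoc, Finset.mul_sum]
    _ ≤ 2 ^ p * 2 ^ (j : ℝ) * ∑ R ∈ G, K * volume R.set := by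
        refine mul_le_mul_right (Finset.sum_le_sum fun R hR => ?_) _
        refine le_trans ?_ (hK R (hGF hR))
        gcongr
        exact hP R (hGP R hR)
    _ = _ := by
        rw [← Finset.mul_sum, hsum]
        ring

lemma lintegral_iSup_tents_le (hn : 0 < n) {p : ℝ} (hp : 1 < p)
    (μ : Measure (UpperHalfSpace n)) {σ : (Fin n → ℝ) → ℝ} (hσ : ∀ x, 0 ≤ σ x)
    (hloc : LocallyIntegrable σ volume) {g : (Fin n → ℝ) → ℝ≥0∞} (hg : Measurable g)
    (F : Finset (Cube n)) (hF : ∀ Q ∈ F, ∀ R ∈ F, Nested Q R) {K L : ℝ≥0∞}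
    (hK : ∀ Q ∈ F, density σ Q ^ (p - 1) * μ Q.tent ≤ K * volume Q.set)
    (hL : ∀ Q ∈ F, ∫⁻ x in Q.set, maximalHL (Q.set.indicator σ) x ≤ L * weightMeasure σ Q.set)
    (hfin : ∀ Q ∈ F, (∫⁻ y in Q.set, g y ∂weightMeasure σ) / weightMeasure σ Q.set ≠ ∞) :
    ∫⁻ z, ⨆ Q ∈ F, Q.tent.indicator (fun _ => (density σ Q *
        ((∫⁻ y in Q.set, g y ∂weightMeasure σ) / weightMeasure σ Q.set)) ^ p) z ∂μ ≤
      2 ^ p * geomConst 1 * (2 ^ (2 * p) * geomConst (p - 1)) * (K * L) *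
        ∫⁻ y, g y ^ p ∂weightMeasure σ := by
  set A : Cube n → ℝ≥0∞ := fun Q =>
    (∫⁻ y in Q.set, g y ∂weightMeasure σ) / weightMeasure σ Q.set with hA
  set P : ℤ → Cube n → Prop := fun k Q => (2 : ℝ≥0∞) ^ (k : ℝ) ≤ A Q with hPdef
  set T : ℤ → ℤ → Set (UpperHalfSpace n) := fun k j =>
    tentsOf F fun Q => P k Q ∧ (2 : ℝ≥0∞) ^ (j : ℝ) ≤ density σ Q with hT
  have hTm : ∀ k j, MeasurableSet (T k j) := fun k j => measurableSet_tentsOf _ _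
  have hp0 : 0 < p := by linarith
  -- The supremum is dominated by the double sum because each `Q` contributes through its own pair
  -- of levels; then the lower bounds alone define the sets `T k j`.
  calc _ ≤ ∫⁻ z, ∑' k : ℤ, ∑' j : ℤ, (T k j).indicator (fun _ =>
          (2 : ℝ≥0∞) ^ (((k : ℝ) + 1) * p) * 2 ^ (((j : ℝ) + 1) * p)) z ∂μ := by
        refine lintegral_mono fun z => iSup₂_le fun Q hQ => ?_
        by_cases hz : z ∈ Q.tent
        swap
        · rw [indicator_of_notMem hz]
          exact zero_le
        rw [indicator_of_mem hz, ENNReal.mul_rpow_of_nonneg _ _ hp0.le, mul_comm]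
        have hd : density σ Q ≠ ∞ :=
          ENNReal.div_ne_top (weightMeasure_ne_top hloc Q) Q.volume_ne_zero
        refine (mul_le_mul' (rpow_le_tsum_levels hp0 (hfin Q hQ))
          (rpow_le_tsum_levels hp0 hd)).trans ?_
        rw [← ENNReal.tsum_mul_right]
        refine ENNReal.tsum_le_tsum fun k => ?_
        rw [← ENNReal.tsum_mul_left]
        refine ENNReal.tsum_le_tsum fun j => ?_
        split_ifs with h1 h2
        · rw [indicator_of_mem]
          exact mem_iUnion₂.2 ⟨Q, hQ, mem_iUnion.2 ⟨⟨h1.1, h2.1⟩, hz⟩⟩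
        all_goals simp
    _ = ∑' k : ℤ, (2 : ℝ≥0∞) ^ (((k : ℝ) + 1) * p) *
          ∑' j : ℤ, 2 ^ (((j : ℝ) + 1) * p) * μ (T k j) := by
        rw [lintegral_tsum]
        swap
        · exact fun k => (Measurable.tsum fun j =>
            measurable_const.indicator (hTm k j)).aemeasurable
        refine tsum_congr fun k => ?_
        rw [lintegral_tsum fun j => (measurable_const.indicator (hTm k j)).aemeasurable,
          ← ENNReal.tsum_mul_left]
        refine tsum_congr fun j => ?_
        rw [lintegral_indicator_const (hTm k j), mul_assoc]
    _ ≤ ∑' k : ℤ, (2 : ℝ≥0∞) ^ (((k : ℝ) + 1) * p) *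
          (2 ^ p * K * (geomConst 1 * L * weightMeasure σ (unionOf F (P k)))) := by
        refine ENNReal.tsum_le_tsum fun k => ?_
        gcongr
        calc _ ≤ ∑' j : ℤ, 2 ^ p * K * ((2 : ℝ≥0∞) ^ (j : ℝ) *
                volume (unionOf F fun Q => P k Q ∧ (2 : ℝ≥0∞) ^ (j : ℝ) ≤ density σ Q)) :=
              ENNReal.tsum_le_tsum fun j =>
                measure_tents_le hn hp F hF hK j _ fun Q hQ => hQ.2
          _ ≤ _ := by
              rw [ENNReal.tsum_mul_left]
              gcongr
              exact tsum_density_level_le hσ F hF hL (P k)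
    _ = 2 ^ p * geomConst 1 * (K * L) * ∑' k : ℤ, (2 : ℝ≥0∞) ^ (((k : ℝ) + 1) * p) *
          weightMeasure σ (unionOf F (P k)) := by
        rw [← ENNReal.tsum_mul_left]
        exact tsum_congr fun k => by ring
    _ ≤ 2 ^ p * geomConst 1 * (K * L) * (2 ^ (2 * p) * geomConst (p - 1) *
          ∫⁻ y, g y ^ p ∂weightMeasure σ) := by
        gcongr
        exact tsum_level_measure_le hp _ hg F hF fun Q _ => weightMeasure_ne_top hloc Q
    _ = _ := by ring

/-! ### Triadic grids -/

/-- The cube of side `3 ^ m` whose lower corner is `3 ^ m / 2` times an integer vector. Those with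
a fixed parity of the integer vector form a grid. -/
noncomputable def gridCube (i : ℤ × (Fin n → ℤ)) : Cube n where
  corner j := (3 : ℝ) ^ i.1 / 2 * i.2 j
  side := (3 : ℝ) ^ i.1
  side_pos := by positivity

/-- The parity of the corner of a grid cube. -/
def parity (i : ℤ × (Fin n → ℤ)) : Fin n → Bool := fun j => decide (i.2 j % 2 = 0)

/-- In units of half the smaller side, both cubes have integer endpoints in every coordinate. Powers
of `3` are odd, so equal parity of the index vectors makes these endpoints congruent mod `2`. Hence
an interval of length `2` cannot straddle an endpoint of the larger one. -/
lemma gridCube_nested_of_le {i k : ℤ × (Fin n → ℤ)} (h : parity i = parity k) (hik : i.1 ≤ k.1) :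
    (gridCube i).set ⊆ (gridCube k).set ∨ Disjoint (gridCube i).set (gridCube k).set := by
  obtain ⟨d, hd⟩ := Int.le.dest hik
  obtain ⟨e, he⟩ : ∃ e : ℤ, (3 : ℤ) ^ d = 2 * e + 1 := Odd.pow (by decide)
  have hpos : (0 : ℝ) < 3 ^ i.1 / 2 := by positivity
  set a : ℝ := 3 ^ i.1 / 2 with ha
  have h3 : (3 : ℝ) ^ i.1 = 2 * a := by rw [ha]; ring
  have hk : (3 : ℝ) ^ k.1 = 2 * a * (2 * e + 1) := by
    rw [← hd, zpow_add₀ (by norm_num), h3, zpow_natCast]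
    congr 1
    exact_mod_cast he
  have hcube : ∀ x : Fin n → ℝ, x ∈ (gridCube i).set ↔
      ∀ j, a * i.2 j ≤ x j ∧ x j < a * i.2 j + 2 * a := fun x => by
    simp only [Cube.set, gridCube, mem_univ_pi, mem_Ico, h3]
    rw [show 2 * a / 2 = a by ring]
  have hcube' : ∀ x : Fin n → ℝ, x ∈ (gridCube k).set ↔
      ∀ j, a * ((2 * e + 1) * k.2 j) ≤ x j ∧
        x j < a * ((2 * e + 1) * k.2 j) + 2 * a * (2 * e + 1) := fun x => by
    simp only [Cube.set, gridCube, mem_univ_pi, mem_Ico, hk]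
    rw [show 2 * a * (2 * (e : ℝ) + 1) / 2 = a * (2 * e + 1) by ring]
    simp only [mul_assoc]
  have hpar : ∀ j, i.2 j % 2 = ((2 * e + 1) * k.2 j) % 2 := fun j => by
    have h1 : (i.2 j % 2 = 0) ↔ (k.2 j % 2 = 0) := by
      simpa [parity] using congrFun h j
    have h2 : (2 * e + 1) * k.2 j = 2 * (e * k.2 j) + k.2 j := by ring
    omega
  by_cases hall : ∀ j, (2 * e + 1) * k.2 j ≤ i.2 j ∧
      i.2 j + 2 ≤ (2 * e + 1) * k.2 j + 2 * (2 * e + 1)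
  · left
    intro x hx
    rw [hcube] at hx
    rw [hcube']
    intro j
    obtain ⟨h1, h2⟩ := hall j
    have h1' : ((2 * e + 1) * k.2 j : ℝ) ≤ i.2 j := by exact_mod_cast h1
    have h2' : (i.2 j + 2 : ℝ) ≤ (2 * e + 1) * k.2 j + 2 * (2 * e + 1) := by exact_mod_cast h2
    have h3 := mul_le_mul_of_nonneg_left h1' hpos.le
    have h4 := mul_le_mul_of_nonneg_left h2' hpos.le
    have h5 := hx j
    constructor <;> nlinarith
  · right
    push Not at hall
    obtain ⟨j, hj⟩ := hall
    rw [Set.disjoint_left]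
    intro x hx hx'
    rw [hcube] at hx
    rw [hcube'] at hx'
    have h5 := hx j
    have h6 := hx' j
    have hp := hpar j
    have hcase : i.2 j + 2 ≤ (2 * e + 1) * k.2 j ∨
        (2 * e + 1) * k.2 j + 2 * (2 * e + 1) ≤ i.2 j := by
      generalize (2 * e + 1) * k.2 j = q at *
      by_cases hq : q ≤ i.2 j
      · have := hj hq
        omega
      · omega
    rcases hcase with h7 | h7
    · have h7' : (i.2 j + 2 : ℝ) ≤ (2 * e + 1) * k.2 j := by exact_mod_cast h7
      have h8 := mul_le_mul_of_nonneg_left h7' hpos.le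
      nlinarith
    · have h7' : ((2 * e + 1) * k.2 j + 2 * (2 * e + 1) : ℝ) ≤ i.2 j := by exact_mod_cast h7
      have h8 := mul_le_mul_of_nonneg_left h7' hpos.le
      nlinarith

lemma gridCube_nested {i k : ℤ × (Fin n → ℤ)} (h : parity i = parity k) :
    Nested (gridCube i) (gridCube k) := by
  rcases le_total i.1 k.1 with hik | hik
  · rcases gridCube_nested_of_le h hik with h | h
    · exact Or.inl h
    · exact Or.inr (Or.inr h)
  · rcases gridCube_nested_of_le h.symm hik with h | h
    · exact Or.inr (Or.inl h)
    · exact Or.inr (Or.inr h.symm)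

/-- The side inequality is strict because the maximal operator admits `t = l(Q)` while a tent
requires `t` below the side. -/
lemma exists_gridCube (Q : Cube n) : ∃ i : ℤ × (Fin n → ℤ), Q.set ⊆ (gridCube i).set ∧
    Q.side < (gridCube i).side ∧ (gridCube i).side ≤ 6 * Q.side := by
  have hl := Q.side_pos
  -- With `3 ^ m ≤ 6 l < 3 ^ (m + 1)`, the grid spacing `3 ^ m / 2` exceeds `l`, so rounding the
  -- corner down leaves `Q` inside two spacings.
  obtain ⟨m, hm1, hm2⟩ := exists_mem_Ico_zpow (x := 6 * Q.side) (y := 3) (by positivity)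
    (by norm_num)
  rw [zpow_add_one₀ (by norm_num)] at hm2
  have ha : (0 : ℝ) < 3 ^ m / 2 := by positivity
  refine ⟨(m, fun j => ⌊Q.corner j / (3 ^ m / 2)⌋), ?_, ?_, hm1⟩
  · intro x hx j _
    obtain ⟨h1, h2⟩ := hx j (mem_univ j)
    have h3 := Int.floor_le (Q.corner j / (3 ^ m / 2))
    have h4 := Int.lt_floor_add_one (Q.corner j / (3 ^ m / 2))
    rw [le_div_iff₀ ha] at h3
    rw [div_lt_iff₀ ha] at h4
    simp only [gridCube, mem_Ico]
    constructor <;> nlinarith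
  · simp only [gridCube]
    linarith

lemma average_le_gridCube {Q R : Cube n} (hQR : Q.set ⊆ R.set) (hside : R.side ≤ 6 * Q.side)
    (g : (Fin n → ℝ) → ℝ) : Q.average g ≤ 6 ^ n * R.average g := by
  have hv : volume R.set ≤ 6 ^ n * volume Q.set := by
    rw [R.volume_set, Q.volume_set, ← mul_pow]
    gcongr
    rw [show (6 : ℝ≥0∞) = ENNReal.ofReal 6 by simp, ← ENNReal.ofReal_mul (by norm_num)]
    exact ENNReal.ofReal_le_ofReal hside
  rw [Cube.average, Cube.average, ENNReal.div_le_iff Q.volume_ne_zero Q.volume_ne_top]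
  calc ∫⁻ y in Q.set, ‖g y‖ₑ ≤ ∫⁻ y in R.set, ‖g y‖ₑ := lintegral_mono_set hQR
    _ = (∫⁻ y in R.set, ‖g y‖ₑ) / volume R.set * volume R.set :=
        (ENNReal.div_mul_cancel R.volume_ne_zero R.volume_ne_top).symm
    _ ≤ (∫⁻ y in R.set, ‖g y‖ₑ) / volume R.set * (6 ^ n * volume Q.set) := by gcongr
    _ = _ := by ring

lemma maximalUpper_rpow_le {p : ℝ} (hp : 0 < p) (g : (Fin n → ℝ) → ℝ) (z : UpperHalfSpace n) :
    maximalUpper g z ^ p ≤ (6 ^ n : ℝ≥0∞) ^ p * ⨆ i : ℤ × (Fin n → ℤ),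
      (gridCube i).tent.indicator (fun _ => (gridCube i).average g ^ p) z := by
  rw [← ENNReal.le_rpow_inv_iff hp, maximalUpper]
  refine iSup_le fun Q => iSup₂_le fun hx ht => ?_
  obtain ⟨i, hsub, hlt, hle⟩ := exists_gridCube Q
  rw [ENNReal.le_rpow_inv_iff hp]
  calc _ ≤ (6 ^ n * (gridCube i).average g) ^ p := by
        gcongr
        exact average_le_gridCube hsub hle g
    _ = (6 ^ n : ℝ≥0∞) ^ p * (gridCube i).average g ^ p := ENNReal.mul_rpow_of_nonneg _ _ hp.le
    _ ≤ _ := by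
        gcongr
        refine le_iSup_of_le i ?_
        rw [indicator_of_mem]
        exact ⟨hsub hx, ht.trans_lt hlt⟩

/-! ### Summing over the entropy levels -/

/-- On `(2 ^ r / 2, 2 ^ r]` monotonicity gives `ε t * t ≤ ε (2 ^ r) * 2 ^ r`, and the length is half
of `2 ^ r`. The case `r = 0` is why the integral starts at `1 / 2`. -/
lemma tsum_inv_eps_le {ε : ℝ → ℝ} (hmono : MonotoneOn ε (Ioi (1 / 2)))
    (hpos : ∀ t ∈ Ioi (1 / 2 : ℝ), 0 < ε t)
    (hint : (∫ t in Ioi (1 / 2 : ℝ), 1 / (ε t * t)) = 1) :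
    ∑' r : ℕ, ENNReal.ofReal (1 / ε (2 ^ r)) ≤ 2 := by
  -- A non-integrable function has integral `0` by convention, so the value `1` forces
  -- integrability.
  have hI : IntegrableOn (fun t => 1 / (ε t * t)) (Ioi (1 / 2 : ℝ)) := by
    by_contra h
    rw [integral_undef h] at hint
    exact zero_ne_one hint
  have hlin : ∫⁻ t in Ioi (1 / 2 : ℝ), ENNReal.ofReal (1 / (ε t * t)) = 1 := by
    rw [← ofReal_integral_eq_lintegral_ofReal hI, hint, ENNReal.ofReal_one]
    refine (ae_restrict_iff' measurableSet_Ioi).2 (Filter.Eventually.of_forall fun t ht => ?_)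
    have h1 := hpos t ht
    have h2 : (0 : ℝ) < t := lt_trans (by norm_num) ht
    simp only [Pi.zero_apply]
    positivity
  set J : ℕ → Set ℝ := fun r => Ioc (2 ^ r / 2) (2 ^ r) with hJ
  have hJs : ∀ r, J r ⊆ Ioi (1 / 2) := fun r t ht => by
    have : (1 : ℝ) ≤ 2 ^ r := one_le_pow₀ (by norm_num)
    exact lt_of_le_of_lt (by linarith) ht.1
  have hdis : Pairwise (Function.onFun Disjoint J) := by
    refine (pairwise_disjoint_on J).2 fun a b hab => Set.disjoint_left.2 fun t h1 h2 => ?_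
    have h3 : (2 : ℝ) ^ (a + 1) ≤ 2 ^ b := pow_le_pow_right₀ (by norm_num) hab
    rw [pow_succ] at h3
    linarith [h1.2, h2.1]
  have hstep : ∀ r, ENNReal.ofReal (1 / ε (2 ^ r)) ≤
      2 * ∫⁻ t in J r, ENNReal.ofReal (1 / (ε t * t)) := fun r => by
    have h2r : (0 : ℝ) < 2 ^ r := by positivity
    have hmem : (2 : ℝ) ^ r ∈ Ioi (1 / 2 : ℝ) := hJs r ⟨by linarith, le_rfl⟩
    have hε := hpos _ hmem
    calc _ = 2 * ∫⁻ _ in J r, ENNReal.ofReal (1 / (ε (2 ^ r) * 2 ^ r)) := by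
          rw [setLIntegral_const, hJ, Real.volume_Ioc, ← ENNReal.ofReal_mul (by positivity),
            show (2 : ℝ≥0∞) = ENNReal.ofReal 2 by simp, ← ENNReal.ofReal_mul (by norm_num)]
          congr 1
          field_simp
          ring
      _ ≤ _ := by
          gcongr 2 * ?_
          refine setLIntegral_mono' measurableSet_Ioc fun t ht => ENNReal.ofReal_le_ofReal ?_
          have h1 := hpos t (hJs r ht)
          have h2 : (0 : ℝ) < t := lt_trans (by positivity) ht.1
          have h3 := hmono (hJs r ht) hmem ht.2
          exact one_div_le_one_div_of_le (by positivity) (mul_le_mul h3 ht.2 h2.le hε.le)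
  calc _ ≤ ∑' r, 2 * ∫⁻ t in J r, ENNReal.ofReal (1 / (ε t * t)) := ENNReal.tsum_le_tsum hstep
    _ = 2 * ∫⁻ t in ⋃ r, J r, ENNReal.ofReal (1 / (ε t * t)) := by
        rw [ENNReal.tsum_mul_left, lintegral_iUnion (fun r => measurableSet_Ioc) hdis]
    _ ≤ 2 * ∫⁻ t in Ioi (1 / 2 : ℝ), ENNReal.ofReal (1 / (ε t * t)) := by
        gcongr
        exact iUnion_subset hJs
    _ = 2 := by rw [hlin, mul_one]

/-- The cubes whose entropy lies in `[2 ^ r, 2 ^ (r + 1))`. -/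
def EntropyLevel (σ : (Fin n → ℝ) → ℝ) (r : ℕ) (Q : Cube n) : Prop :=
  weightMeasure σ Q.set ≠ 0 ∧ 2 ^ r ≤ entropy σ Q ∧ entropy σ Q < 2 ^ (r + 1)

lemma exists_entropyLevel {σ : (Fin n → ℝ) → ℝ} (hσ : ∀ x, 0 ≤ σ x)
    (hloc : LocallyIntegrable σ volume) {Q : Cube n} (hQ : weightMeasure σ Q.set ≠ 0)
    (htop : entropy σ Q ≠ ∞) : ∃ r, EntropyLevel σ r Q := by
  have h1 := one_le_entropy hσ hloc hQ
  have h1' : 1 ≤ (entropy σ Q).toReal := by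
    simpa using ENNReal.toReal_mono htop h1
  obtain ⟨r, hr1, hr2⟩ := exists_nat_pow_near h1' one_lt_two
  have e : ∀ s : ℕ, (2 : ℝ≥0∞) ^ s = ENNReal.ofReal (2 ^ s) := fun s => by
    rw [ENNReal.ofReal_pow (by norm_num)]; simp
  refine ⟨r, hQ, ?_, ?_⟩
  · rw [e]; exact ENNReal.ofReal_le_of_le_toReal hr1
  · rw [e]; exact (ENNReal.lt_ofReal_iff_toReal_lt htop).2 hr2

lemma lintegral_maximalHL_le_of_entropyLevel {σ : (Fin n → ℝ) → ℝ}
    (hloc : LocallyIntegrable σ volume) {r : ℕ} {Q : Cube n} (h : EntropyLevel σ r Q) :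
    ∫⁻ x in Q.set, maximalHL (Q.set.indicator σ) x ≤ 2 ^ (r + 1) * weightMeasure σ Q.set := by
  rw [← ENNReal.div_le_iff h.1 (weightMeasure_ne_top hloc Q)]
  exact h.2.2.le

lemma bump_mul_measure_le (p : ℝ) (ε : ℝ → ℝ) (μ : Measure (UpperHalfSpace n))
    (σ : (Fin n → ℝ) → ℝ) (Q : Cube n) :
    bump ε (entropy σ Q) * density σ Q ^ (p - 1) * μ Q.tent ≤
      entropyBumpConst p ε μ σ * volume Q.set := by
  calc _ = bump ε (entropy σ Q) * density σ Q ^ (p - 1) * (μ Q.tent / volume Q.set) *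
        volume Q.set := by
        rw [mul_assoc _ (μ Q.tent / volume Q.set),
          ENNReal.div_mul_cancel Q.volume_ne_zero Q.volume_ne_top]
    _ ≤ _ := by
        gcongr
        exact le_iSup (fun Q : Cube n => bump ε (entropy σ Q) *
          (weightMeasure σ Q.set / volume Q.set) ^ (p - 1) * (μ Q.tent / volume Q.set)) Q

lemma density_rpow_mul_measure_le {p : ℝ} {ε : ℝ → ℝ} {μ : Measure (UpperHalfSpace n)}
    {σ : (Fin n → ℝ) → ℝ} (hmono : MonotoneOn ε (Ioi (1 / 2)))
    (hpos : ∀ t ∈ Ioi (1 / 2 : ℝ), 0 < ε t) {r : ℕ} {Q : Cube n} (h : EntropyLevel σ r Q) :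
    density σ Q ^ (p - 1) * μ Q.tent ≤
      ((2 : ℝ≥0∞) ^ r)⁻¹ * ENNReal.ofReal (1 / ε (2 ^ r)) * entropyBumpConst p ε μ σ *
        volume Q.set := by
  have htop : entropy σ Q ≠ ∞ := h.2.2.ne_top
  have h1 : (1 : ℝ) ≤ 2 ^ r := one_le_pow₀ (by norm_num)
  have h2 : (2 : ℝ) ^ r ≤ (entropy σ Q).toReal := by
    simpa using ENNReal.toReal_mono htop h.2.1
  have hmem : (2 : ℝ) ^ r ∈ Ioi (1 / 2 : ℝ) := lt_of_lt_of_le (by norm_num) h1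
  have hε := hpos _ hmem
  have hb : (2 : ℝ≥0∞) ^ r * ENNReal.ofReal (ε (2 ^ r)) ≤ bump ε (entropy σ Q) := by
    rw [bump, if_neg htop]
    gcongr
    · exact h.2.1
    · exact hmono hmem (lt_of_lt_of_le (by norm_num) (h1.trans h2)) h2
  have hc : ((2 : ℝ≥0∞) ^ r)⁻¹ * ENNReal.ofReal (1 / ε (2 ^ r)) *
      ((2 : ℝ≥0∞) ^ r * ENNReal.ofReal (ε (2 ^ r))) = 1 := by
    rw [mul_mul_mul_comm, ENNReal.inv_mul_cancel (by simp) (by simp), one_mul,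
      ← ENNReal.ofReal_mul (by positivity), one_div_mul_cancel hε.ne', ENNReal.ofReal_one]
  calc _ = ((2 : ℝ≥0∞) ^ r)⁻¹ * ENNReal.ofReal (1 / ε (2 ^ r)) *
        ((2 : ℝ≥0∞) ^ r * ENNReal.ofReal (ε (2 ^ r))) * (density σ Q ^ (p - 1) * μ Q.tent) := by
        rw [hc, one_mul]
    _ ≤ ((2 : ℝ≥0∞) ^ r)⁻¹ * ENNReal.ofReal (1 / ε (2 ^ r)) *
        (bump ε (entropy σ Q) * density σ Q ^ (p - 1) * μ Q.tent) := by
        rw [mul_assoc _ (_ * _) (_ * _), mul_assoc (bump _ _)]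
        gcongr
    _ ≤ _ := by
        rw [mul_assoc _ (entropyBumpConst p ε μ σ)]
        refine mul_le_mul_right ?_ _
        exact bump_mul_measure_le p ε μ σ Q

/-- For infinite entropy the bump factor is `∞` and the density is positive, so a finite bump
constant leaves no room for a tent of positive measure. -/
lemma measure_tent_eq_zero {p : ℝ} {ε : ℝ → ℝ} {μ : Measure (UpperHalfSpace n)}
    {σ : (Fin n → ℝ) → ℝ} (hloc : LocallyIntegrable σ volume)
    (hB : entropyBumpConst p ε μ σ ≠ ∞) {Q : Cube n} (hQ : weightMeasure σ Q.set ≠ 0)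
    (htop : entropy σ Q = ∞) : μ Q.tent = 0 := by
  by_contra h0
  have h := bump_mul_measure_le p ε μ σ Q
  have hd0 : density σ Q ≠ 0 := (ENNReal.div_pos hQ Q.volume_ne_top).ne'
  have hdt : density σ Q ≠ ∞ := ENNReal.div_ne_top (weightMeasure_ne_top hloc Q) Q.volume_ne_zero
  have hd : density σ Q ^ (p - 1) ≠ 0 := (ENNReal.rpow_pos (pos_iff_ne_zero.2 hd0) hdt).ne'
  rw [bump, if_pos htop, ENNReal.top_mul hd, ENNReal.top_mul h0, top_le_iff] at h
  exact ENNReal.mul_ne_top hB Q.volume_ne_top h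

/-- The constant of the estimate over one grid. -/
noncomputable def gridConst (p : ℝ) : ℝ≥0∞ :=
  2 ^ p * geomConst 1 * (2 ^ (2 * p) * geomConst (p - 1)) * 4

lemma gridConst_ne_top {p : ℝ} (hp : 1 < p) : gridConst p ≠ ∞ := by
  have h1 := geomConst_ne_top one_pos
  have h2 := geomConst_ne_top (sub_pos.2 hp)
  have h3 : ∀ x : ℝ, (2 : ℝ≥0∞) ^ x ≠ ∞ := fun x => by simp
  exact ENNReal.mul_ne_top (ENNReal.mul_ne_top (ENNReal.mul_ne_top (h3 _) h1)
    (ENNReal.mul_ne_top (h3 _) h2)) (by norm_num)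

lemma gridConst_ne_zero (p : ℝ) : gridConst p ≠ 0 := by
  have h3 : ∀ x : ℝ, (2 : ℝ≥0∞) ^ x ≠ 0 := fun x =>
    (ENNReal.rpow_pos (by norm_num) (by norm_num)).ne'
  simp [gridConst, geomConst_ne_zero, h3]

lemma measurable_iSup_tents (F : Finset (Cube n)) (c : Cube n → ℝ≥0∞) :
    Measurable fun z => ⨆ Q ∈ F, Q.tent.indicator (fun _ => c Q) z :=
  Measurable.biSup _ F.countable_toSet fun Q _ => measurable_const.indicator Q.measurableSet_tent

lemma lintegral_iSup_tents_le_entropyBumpConst (hn : 0 < n) {p : ℝ} (hp : 1 < p) {ε : ℝ → ℝ}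
    {μ : Measure (UpperHalfSpace n)} {σ : (Fin n → ℝ) → ℝ} (hσ : ∀ x, 0 ≤ σ x)
    (hloc : LocallyIntegrable σ volume) (hmono : MonotoneOn ε (Ioi (1 / 2)))
    (hpos : ∀ t ∈ Ioi (1 / 2 : ℝ), 0 < ε t)
    (hint : (∫ t in Ioi (1 / 2 : ℝ), 1 / (ε t * t)) = 1)
    (hB : entropyBumpConst p ε μ σ ≠ ∞) {g : (Fin n → ℝ) → ℝ≥0∞} (hg : Measurable g)
    (hfin : ∀ Q : Cube n, (∫⁻ y in Q.set, g y ∂weightMeasure σ) / weightMeasure σ Q.set ≠ ∞)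
    (F : Finset (Cube n)) (hF : ∀ Q ∈ F, ∀ R ∈ F, Nested Q R) :
    ∫⁻ z, ⨆ Q ∈ F, Q.tent.indicator (fun _ => (density σ Q *
        ((∫⁻ y in Q.set, g y ∂weightMeasure σ) / weightMeasure σ Q.set)) ^ p) z ∂μ ≤
      gridConst p * entropyBumpConst p ε μ σ * ∫⁻ y, g y ^ p ∂weightMeasure σ := by
  classical
  set B := entropyBumpConst p ε μ σ
  set c : Cube n → ℝ≥0∞ := fun Q => (density σ Q *
        ((∫⁻ y in Q.set, g y ∂weightMeasure σ) / weightMeasure σ Q.set)) ^ p with hc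
  set F' : ℕ → Finset (Cube n) := fun r => F.filter (EntropyLevel σ r) with hF'
  set D : ℝ≥0∞ := 2 ^ p * geomConst 1 * (2 ^ (2 * p) * geomConst (p - 1)) with hD
  have hnull : ∀ᵐ z ∂μ, ∀ Q ∈ F, weightMeasure σ Q.set ≠ 0 → entropy σ Q = ∞ → z ∉ Q.tent := by
    rw [Filter.eventually_all_finset]
    intro Q _
    by_cases h : weightMeasure σ Q.set ≠ 0 ∧ entropy σ Q = ∞
    · have := measure_eq_zero_iff_ae_notMem.1 (measure_tent_eq_zero hloc hB h.1 h.2)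
      filter_upwards [this] with z hz _ _ using hz
    · exact Filter.Eventually.of_forall fun z h1 h2 => absurd ⟨h1, h2⟩ h
  calc _ ≤ ∫⁻ z, ∑' r : ℕ, ⨆ Q ∈ F' r, Q.tent.indicator (fun _ => c Q) z ∂μ := by
        refine lintegral_mono_ae ?_
        filter_upwards [hnull] with z hz
        refine iSup₂_le fun Q hQ => ?_
        by_cases hzQ : z ∈ Q.tent
        swap
        · rw [indicator_of_notMem hzQ]
          exact zero_le
        by_cases h0 : weightMeasure σ Q.set = 0
        · have : c Q = 0 := by
            simp [hc, density, h0, (zero_lt_one.trans hp)]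
          rw [indicator_of_mem hzQ]
          change c Q ≤ _
          rw [this]
          exact zero_le
        obtain ⟨r, hr⟩ := exists_entropyLevel hσ hloc h0 fun h => hz Q hQ h0 h hzQ
        refine le_trans ?_ (ENNReal.le_tsum r)
        exact le_iSup₂ (f := fun Q (_ : Q ∈ F' r) => Q.tent.indicator (fun _ => c Q) z) Q
          (Finset.mem_filter.2 ⟨hQ, hr⟩)
    _ = ∑' r : ℕ, ∫⁻ z, ⨆ Q ∈ F' r, Q.tent.indicator (fun _ => c Q) z ∂μ :=
        lintegral_tsum fun r => (measurable_iSup_tents _ _).aemeasurable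
    _ ≤ ∑' r : ℕ, D * ((((2 : ℝ≥0∞) ^ r)⁻¹ * ENNReal.ofReal (1 / ε (2 ^ r)) * B) * 2 ^ (r + 1)) *
          ∫⁻ y, g y ^ p ∂weightMeasure σ := by
        refine ENNReal.tsum_le_tsum fun r => ?_
        refine lintegral_iSup_tents_le hn hp μ hσ hloc hg (F' r) (fun Q hQ R hR =>
          hF Q (Finset.mem_filter.1 hQ).1 R (Finset.mem_filter.1 hR).1) (fun Q hQ =>
          density_rpow_mul_measure_le hmono hpos (Finset.mem_filter.1 hQ).2) (fun Q hQ =>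
          lintegral_maximalHL_le_of_entropyLevel hloc (Finset.mem_filter.1 hQ).2)
          fun Q _ => hfin Q
    _ = ∑' r : ℕ, ENNReal.ofReal (1 / ε (2 ^ r)) *
          (D * 2 * B * ∫⁻ y, g y ^ p ∂weightMeasure σ) := by
        refine tsum_congr fun r => ?_
        have h2 : ((2 : ℝ≥0∞) ^ r)⁻¹ * 2 ^ r = 1 := ENNReal.inv_mul_cancel (by simp) (by simp)
        calc _ = (((2 : ℝ≥0∞) ^ r)⁻¹ * 2 ^ r) * (ENNReal.ofReal (1 / ε (2 ^ r)) *
              (D * 2 * B * ∫⁻ y, g y ^ p ∂weightMeasure σ)) := by ring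
          _ = _ := by rw [h2, one_mul]
    -- The outer `2` bounds `∑ 1 / ε(2 ^ r)`, the inner one is `2 ^ (r + 1) / 2 ^ r`; together they
    -- give the `4` in `gridConst`.
    _ ≤ 2 * (D * 2 * B * ∫⁻ y, g y ^ p ∂weightMeasure σ) := by
        rw [ENNReal.tsum_mul_right]
        gcongr
        exact tsum_inv_eps_le hmono hpos hint
    _ = _ := by
        rw [gridConst]
        ring

/-! ### From finite nested families to the maximal operator -/

lemma lintegral_iSup_gridCube_le (hn : 0 < n) {p : ℝ} (hp : 1 < p) {ε : ℝ → ℝ}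
    {μ : Measure (UpperHalfSpace n)} {σ : (Fin n → ℝ) → ℝ} (hσ : ∀ x, 0 ≤ σ x)
    (hloc : LocallyIntegrable σ volume) (hmono : MonotoneOn ε (Ioi (1 / 2)))
    (hpos : ∀ t ∈ Ioi (1 / 2 : ℝ), 0 < ε t)
    (hint : (∫ t in Ioi (1 / 2 : ℝ), 1 / (ε t * t)) = 1)
    (hB : entropyBumpConst p ε μ σ ≠ ∞) {g : (Fin n → ℝ) → ℝ≥0∞} (hg : Measurable g)
    (hfin : ∀ Q : Cube n, (∫⁻ y in Q.set, g y ∂weightMeasure σ) / weightMeasure σ Q.set ≠ ∞) :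
    ∫⁻ z, ⨆ i : ℤ × (Fin n → ℤ), (gridCube i).tent.indicator (fun _ => (density σ (gridCube i) *
        ((∫⁻ y in (gridCube i).set, g y ∂weightMeasure σ) /
          weightMeasure σ (gridCube i).set)) ^ p) z ∂μ ≤
      2 ^ n * (gridConst p * entropyBumpConst p ε μ σ * ∫⁻ y, g y ^ p ∂weightMeasure σ) := by
  classical
  set c : Cube n → ℝ≥0∞ := fun Q => (density σ Q *
        ((∫⁻ y in Q.set, g y ∂weightMeasure σ) / weightMeasure σ Q.set)) ^ p with hc
  have hm : ∀ s : Finset (ℤ × (Fin n → ℤ)), Measurable fun z =>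
      ⨆ i ∈ s, (gridCube i).tent.indicator (fun _ => c (gridCube i)) z := fun s =>
    Measurable.biSup _ s.countable_toSet fun i _ =>
      measurable_const.indicator (gridCube i).measurableSet_tent
  -- Monotone convergence along finite sets of indices reduces to finite families; each is then
  -- split into its `2 ^ n` parity classes.
  calc _ = ∫⁻ z, ⨆ s : Finset (ℤ × (Fin n → ℤ)), ⨆ i ∈ s,
          (gridCube i).tent.indicator (fun _ => c (gridCube i)) z ∂μ :=
        lintegral_congr fun z => iSup_eq_iSup_finset _
    _ = ⨆ s : Finset (ℤ × (Fin n → ℤ)), ∫⁻ z, ⨆ i ∈ s,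
          (gridCube i).tent.indicator (fun _ => c (gridCube i)) z ∂μ := by
        refine lintegral_iSup_directed (fun s => (hm s).aemeasurable) ?_
        refine Monotone.directed_le fun s t hst z => ?_
        exact biSup_mono fun i hi => hst hi
    _ ≤ _ := iSup_le fun s => ?_
  set F : (Fin n → Bool) → Finset (Cube n) := fun b => 
      (s.filter fun i => parity i = b).image gridCube with hFdef
  have hnest : ∀ b, ∀ Q ∈ F b, ∀ R ∈ F b, Nested Q R := by
    intro b Q hQ R hR
    obtain ⟨i, hi, rfl⟩ := Finset.mem_image.1 hQ
    obtain ⟨k, hk, rfl⟩ := Finset.mem_image.1 hR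
    exact gridCube_nested ((Finset.mem_filter.1 hi).2.trans (Finset.mem_filter.1 hk).2.symm)
  calc _ ≤ ∫⁻ z, ∑ b : Fin n → Bool, ⨆ Q ∈ F b, Q.tent.indicator (fun _ => c Q) z ∂μ := by
        refine lintegral_mono fun z => iSup₂_le fun i hi => ?_
        refine le_trans ?_ (Finset.single_le_sum (fun _ _ => zero_le) (Finset.mem_univ (parity i)))
        exact le_iSup₂ (f := fun Q (_ : Q ∈ F (parity i)) => Q.tent.indicator (fun _ => c Q) z)
          (gridCube i) (Finset.mem_image_of_mem _ (Finset.mem_filter.2 ⟨hi, rfl⟩))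
    _ = ∑ b : Fin n → Bool, ∫⁻ z, ⨆ Q ∈ F b, Q.tent.indicator (fun _ => c Q) z ∂μ :=
        lintegral_finsetSum _ fun b _ => measurable_iSup_tents _ _
    _ ≤ ∑ b : Fin n → Bool,
          gridConst p * entropyBumpConst p ε μ σ * ∫⁻ y, g y ^ p ∂weightMeasure σ :=
        Finset.sum_le_sum fun b _ => lintegral_iSup_tents_le_entropyBumpConst hn hp hσ hloc hmono
          hpos hint hB hg hfin (F b) (hnest b)
    _ = _ := by simp

/-- Since `g ≤ 1 + g ^ p` and `σ(Q)` is finite, `g` is integrable on `Q`. This supplies the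
finiteness needed to place averages in dyadic levels. -/
lemma setLIntegral_div_ne_top {p : ℝ} (hp : 1 < p) {σ : (Fin n → ℝ) → ℝ}
    (hloc : LocallyIntegrable σ volume) {g : (Fin n → ℝ) → ℝ≥0∞}
    (hfin : ∫⁻ y, g y ^ p ∂weightMeasure σ ≠ ∞) (Q : Cube n) :
    (∫⁻ y in Q.set, g y ∂weightMeasure σ) / weightMeasure σ Q.set ≠ ∞ := by
  by_cases h0 : weightMeasure σ Q.set = 0
  · rw [Measure.restrict_eq_zero.2 h0]
    simp
  refine ENNReal.div_ne_top (ne_top_of_le_ne_top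
    (ENNReal.add_ne_top.2 ⟨weightMeasure_ne_top hloc Q, hfin⟩) ?_) h0
  calc _ ≤ ∫⁻ y in Q.set, (1 + g y ^ p) ∂weightMeasure σ := by
        refine lintegral_mono fun y => ?_
        rcases le_total (g y) 1 with h | h
        · exact h.trans le_self_add
        · refine le_trans ?_ le_add_self
          simpa using ENNReal.rpow_le_rpow_of_exponent_le h hp.le
    _ = weightMeasure σ Q.set + ∫⁻ y in Q.set, g y ^ p ∂weightMeasure σ := by
        rw [lintegral_add_left measurable_const]
        simp
    _ ≤ _ := by
        gcongr
        exact Measure.restrict_le_self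

lemma lintegral_maximalUpper_rpow_le (hn : 0 < n) {p : ℝ} (hp : 1 < p) {ε : ℝ → ℝ}
    {μ : Measure (UpperHalfSpace n)} {σ : (Fin n → ℝ) → ℝ} (hσ : ∀ x, 0 ≤ σ x)
    (hloc : LocallyIntegrable σ volume) (hmono : MonotoneOn ε (Ioi (1 / 2)))
    (hpos : ∀ t ∈ Ioi (1 / 2 : ℝ), 0 < ε t)
    (hint : (∫ t in Ioi (1 / 2 : ℝ), 1 / (ε t * t)) = 1)
    (hB : entropyBumpConst p ε μ σ ≠ ∞) {f : (Fin n → ℝ) → ℝ}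
    (hf : AEStronglyMeasurable f (weightMeasure σ))
    (hfin : ∫⁻ y, ‖f y‖ₑ ^ p ∂weightMeasure σ ≠ ∞) :
    ∫⁻ z, maximalUpper (fun y => f y * σ y) z ^ p ∂μ ≤
      (6 ^ n : ℝ≥0∞) ^ p * (2 ^ n * (gridConst p * entropyBumpConst p ε μ σ *
        ∫⁻ y, ‖f y‖ₑ ^ p ∂weightMeasure σ)) := by
  have hp0 : 0 < p := by linarith
  obtain ⟨g, hg, hfg⟩ := hf.enorm
  have hfg' : ∫⁻ y, ‖f y‖ₑ ^ p ∂weightMeasure σ = ∫⁻ y, g y ^ p ∂weightMeasure σ :=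
    lintegral_congr_ae (hfg.mono fun y hy => by simp only [hy])
  rw [hfg'] at hfin ⊢
  calc _ ≤ ∫⁻ z, (6 ^ n : ℝ≥0∞) ^ p * ⨆ i : ℤ × (Fin n → ℤ), (gridCube i).tent.indicator
          (fun _ => (gridCube i).average (fun y => f y * σ y) ^ p) z ∂μ :=
        lintegral_mono fun z => maximalUpper_rpow_le hp0 _ z
    _ = (6 ^ n : ℝ≥0∞) ^ p * ∫⁻ z, ⨆ i : ℤ × (Fin n → ℤ), (gridCube i).tent.indicator
          (fun _ => (gridCube i).average (fun y => f y * σ y) ^ p) z ∂μ :=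
        lintegral_const_mul' _ _ (by simp)
    _ ≤ _ := by
        refine mul_le_mul_right (le_trans (le_of_eq ?_) (lintegral_iSup_gridCube_le hn hp hσ hloc
          hmono hpos hint hB hg (setLIntegral_div_ne_top hp hloc hfin))) _
        refine lintegral_congr fun z => iSup_congr fun i => ?_
        rw [average_mul_eq hσ hloc hf, lintegral_congr_ae (ae_restrict_of_ae hfg), density]

end Carleson

theorem theorem2p4 (n : ℕ) (hn : 0 < n) (p : ℝ) (hp : 1 < p) :
    ∃ C : ℝ≥0, ∀ (μ : Measure (Carleson.UpperHalfSpace n)) (σ : (Fin n → ℝ) → ℝ) (ε : ℝ → ℝ),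
      (∀ x, 0 ≤ σ x) → LocallyIntegrable σ volume →
      MonotoneOn ε (Ioi (1 / 2)) → (∀ t ∈ Ioi (1 / 2 : ℝ), 0 < ε t) →
      (∫ t in Ioi (1 / 2 : ℝ), 1 / (ε t * t)) = 1 →
      Carleson.maximalOpNorm p μ σ ≤
        (C : ℝ≥0∞) * Carleson.entropyBumpConst p ε μ σ ^ (1 / p) := by
  have hp0 : 0 < p := by linarith
  set D : ℝ≥0∞ := (6 ^ n : ℝ≥0∞) ^ p * (2 ^ n * Carleson.gridConst p) with hD
  have hDtop : D ≠ ∞ := ENNReal.mul_ne_top (by simp)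
    (ENNReal.mul_ne_top (by simp) (Carleson.gridConst_ne_top hp))
  -- Nonvanishing makes the right side `∞` when the bump constant is infinite.
  have hD0 : D ≠ 0 := mul_ne_zero (by simp [hp0.not_gt])
    (mul_ne_zero (by simp) (Carleson.gridConst_ne_zero p))
  have hCtop : D ^ (1 / p) ≠ ∞ := ENNReal.rpow_ne_top_of_nonneg (by positivity) hDtop
  have hC0 : D ^ (1 / p) ≠ 0 := (ENNReal.rpow_pos (pos_iff_ne_zero.2 hD0) hDtop).ne'
  refine ⟨(D ^ (1 / p)).toNNReal, fun μ σ ε hσ hloc hmono hpos hint => ?_⟩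
  rw [ENNReal.coe_toNNReal hCtop]
  by_cases hB : Carleson.entropyBumpConst p ε μ σ = ∞
  · rw [hB, ENNReal.top_rpow_of_pos (by positivity), ENNReal.mul_top hC0]
    exact le_top
  refine iSup_le fun f => iSup₂_le fun hf hf1 => ?_
  have hpe0 : ENNReal.ofReal p ≠ 0 := by simpa using hp0
  rw [eLpNorm_eq_lintegral_rpow_enorm_toReal hpe0 ENNReal.ofReal_ne_top,
    ENNReal.toReal_ofReal hp0.le] at hf1 ⊢
  have hf2 : ∫⁻ y, ‖f y‖ₑ ^ p ∂Carleson.weightMeasure σ ≤ 1 := by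
    simpa [one_div, ENNReal.rpow_inv_le_iff hp0] using hf1
  rw [← ENNReal.mul_rpow_of_nonneg _ _ (by positivity)]
  refine ENNReal.rpow_le_rpow ?_ (by positivity)
  simp only [enorm_eq_self]
  refine (Carleson.lintegral_maximalUpper_rpow_le hn hp hσ hloc hmono hpos hint hB hf.1
    (ne_top_of_le_ne_top ENNReal.one_ne_top hf2)).trans ?_
  calc _ ≤ (6 ^ n : ℝ≥0∞) ^ p * (2 ^ n * (Carleson.gridConst p *
        Carleson.entropyBumpConst p ε μ σ * 1)) := by gcongr
    _ = _ := by rw [hD]; ring
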